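/- Let $n,m,q\ge 0$ be integers. A set $C\subseteq\mathbb R^l$ is \emph{semialgebraic} if it is a finite union $C=\bigcup_{j} K_j$ of sets each of the form $K_j=\{f_{1,j}=0,\dots,f_{r_j,j}=0,\ g_{1,j}>0,\dots,g_{s_j,j}>0\}$ with finitely many real polynomials $f_{i,j},g_{h,j}$ in $l$ variables. For a map $f=(f_1,\dots,f_m):\mathbb R^n\to\mathbb R^m$, a point $x$ \emph{dominates} a point $y$ if $f_i(x)\ge f_i(y)$ for all $i$ and $f_j(x)>f_j(y)$ for at least one $j$; a point $p$ is a \emph{local Pareto optimum} of $f$ if it has a neighborhood containing no point that dominates $p$. Identify the vector space of polynomial maps $\mathbb R^n\to\mathbb R^m$ of degree at most $q$ that vanish at $0$ with $\mathbb R^l=\{(a_\iota)_{0<|\iota|\le q} : a_\iota\in\mathbb R^m\}$, where $\iota$ runs over multi-indices in $\mathbb N^n$, by letting $a=(a_\iota)$ correspond to $f(a,x)=\sum_{0<|\iota|\le q}a_\iota x^\iota$. Then the set $$E=\{a\in\mathbb R^l : f(a,\cdot)\text{ has a local Pareto optimum at }0\}$$ is a semialgebraic subset of $\mathbb R^l$.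 -/

import Mathlib

namespace ParetoSemialg

/-- A subset of the real coordinate space `ℝ^σ` is semialgebraic if it is a finite union of sets,
each of which is defined by finitely many polynomial equations `p = 0` and finitely many strict
polynomial inequalities `g > 0`. -/
def IsSemialgebraic {σ : Type*} (C : Set (σ → ℝ)) : Prop :=
  ∃ (N : ℕ) (F G : Fin N → Finset (MvPolynomial σ ℝ)),
    C = ⋃ j : Fin N, {x | (∀ p ∈ F j, MvPolynomial.eval x p = 0) ∧
      (∀ g ∈ G j, 0 < MvPolynomial.eval x g)}

/-- `x` dominates `y` for the objective functions `f₁, …, fₘ` (the components of `f`):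
`fᵢ x ≥ fᵢ y` for all `i`, with strict inequality for at least one index. -/
def Dominates {X : Type*} {m : ℕ} (f : X → Fin m → ℝ) (x y : X) : Prop :=
  (∀ i, f x i ≥ f y i) ∧ ∃ j, f x j > f y j

/-- `x ∈ U` is a Pareto optimum of `f` restricted to `U` if no point of `U` dominates `x`. -/
def IsParetoOptimumOn {X : Type*} {m : ℕ} (f : X → Fin m → ℝ) (U : Set X) (x : X) : Prop :=
  x ∈ U ∧ ¬ ∃ y ∈ U, Dominates f y x

/-- `p` is a local Pareto optimum of `f` if it is Pareto optimal on some neighbourhood of `p`. -/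
def IsLocalParetoOptimum {X : Type*} [TopologicalSpace X] {m : ℕ} (f : X → Fin m → ℝ)
    (p : X) : Prop :=
  ∃ U ∈ nhds p, IsParetoOptimumOn f U p

/-- The finite set of multi-indices `ι ∈ ℕ^n` with `0 < |ι| ≤ q`. -/
def multiIndices (n q : ℕ) : Finset (Fin n → ℕ) :=
  (Fintype.piFinset fun _ => Finset.range (q + 1)).filter
    fun ι => 0 < ∑ i, ι i ∧ ∑ i, ι i ≤ q

theorem mem_multiIndices {n q : ℕ} {ι : Fin n → ℕ} :
    ι ∈ multiIndices n q ↔ 0 < ∑ i, ι i ∧ ∑ i, ι i ≤ q := by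
  simp only [multiIndices, Finset.mem_filter, Fintype.mem_piFinset, Finset.mem_range,
    and_iff_right_iff_imp]
  intro h i
  have := Finset.single_le_sum (f := ι) (fun _ _ => Nat.zero_le _) (Finset.mem_univ i)
  omega

/-- The coordinates of the coefficient space `ℝ^l`: one for every multi-index `ι` with
`0 < |ι| ≤ q` and every component `j` of a map to `ℝ^m`. -/
abbrev CoeffIndex (n m q : ℕ) : Type := multiIndices n q × Fin m

/-- The polynomial map `f(a, ·) : ℝ^n → ℝ^m`, `f(a, x) = ∑_ι a_ι x^ι`, of degree at most `q` and
vanishing at `0`, with coefficient vector `a`. -/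
def polyMap {n m q : ℕ} (a : CoeffIndex n m q → ℝ) (x : Fin n → ℝ) : Fin m → ℝ :=
  fun j => ∑ ι : multiIndices n q, a (ι, j) * ∏ i, x i ^ ι.1 i

end ParetoSemialg

/-! The defining condition of the set is a first-order formula over the reals: some ε > 0 admits no
x in the open ε-cube that dominates 0. The proof is therefore a quantifier elimination in the style
of Cohen and Hörmander, carried out semantically. Instead of producing formulas, it calls a set
sign-determined if membership depends only on the signs of finitely many polynomials. This property
passes to complements, finite intersections and polynomial preimages. A sign-determined set is a
finite union of sign cells, hence semialgebraic.

The substance is projection along one variable (`SignDetermined.exists_update`). For a finite family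
of univariate polynomials with parameters, the arrangement on the line of the roots and signs must
depend on the signs of finitely many functions of the parameters. Two parameter points are compared
by a finite order isomorphism of ℝ that pairs the roots of the two specializations (`Matches`). To
adjoin p of degree d, one needs its critical points and its signs at those points. At a root of q,
the sign of p is that of a pseudo-remainder of degree below d, so everything reduces to lower degree
(`IsDetermined.insert_of_reductions`). Rolle's theorem and the intermediate value theorem then place
the roots of p between the known points (`exists_matches_of_critical`). -/

namespace ParetoSemialg

open Polynomial Set

/-! ### Finite partial order isomorphisms of the real line. -/

/-- `x` and `y` occupy the same position relative to the paired points of `T`. -/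
def SamePosition (T : Finset (ℝ × ℝ)) (x y : ℝ) : Prop :=
  ∀ t ∈ T, (t.1 < x ↔ t.2 < y) ∧ (x < t.1 ↔ y < t.2)

/-- `T` is a finite partial order isomorphism of the real line. -/
def IsPartialIso (T : Finset (ℝ × ℝ)) : Prop :=
  ∀ t ∈ T, SamePosition T t.1 t.2

theorem SamePosition.mono {T T' : Finset (ℝ × ℝ)} (h : T ⊆ T') {x y : ℝ}
    (hxy : SamePosition T' x y) : SamePosition T x y :=
  fun t ht => hxy t (h ht)

theorem IsPartialIso.mono {T T' : Finset (ℝ × ℝ)} (h : T ⊆ T') (hT : IsPartialIso T') :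
    IsPartialIso T :=
  fun t ht => (hT t (h ht)).mono h

theorem SamePosition.eq_iff {T : Finset (ℝ × ℝ)} {x y : ℝ} (h : SamePosition T x y)
    {t : ℝ × ℝ} (ht : t ∈ T) : t.1 = x ↔ t.2 = y := by
  have := h t ht
  grind

theorem SamePosition.swap {T : Finset (ℝ × ℝ)} {x y : ℝ} (h : SamePosition T x y) :
    SamePosition (T.image Prod.swap) y x := by
  intro t ht
  obtain ⟨s, hs, rfl⟩ := Finset.mem_image.1 ht
  exact ⟨(h s hs).1.symm, (h s hs).2.symm⟩

theorem samePosition_of_swap {T : Finset (ℝ × ℝ)} {x y : ℝ}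
    (h : SamePosition (T.image Prod.swap) y x) : SamePosition T x y :=
  fun t ht => by
    have := h t.swap (Finset.mem_image_of_mem _ ht)
    exact ⟨this.1.symm, this.2.symm⟩

theorem IsPartialIso.swap {T : Finset (ℝ × ℝ)} (hT : IsPartialIso T) :
    IsPartialIso (T.image Prod.swap) := by
  intro t ht
  obtain ⟨s, hs, rfl⟩ := Finset.mem_image.1 ht
  exact (hT s hs).swap

/-- The extension step of Cantor's back-and-forth argument: ℝ is a dense order without endpoints. -/
theorem IsPartialIso.exists_samePosition {T : Finset (ℝ × ℝ)} (hT : IsPartialIso T) (x : ℝ) :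
    ∃ y, SamePosition T x y := by
  have hcmp : ∀ p ∈ T, ∀ q ∈ T, cmp p.1 q.1 = cmp p.2 q.2 := by
    intro p hp q hq
    have h := hT p hp q hq
    rcases lt_trichotomy p.1 q.1 with h1 | h1 | h1
    · rw [cmp_eq_lt_iff _ _ |>.2 h1, cmp_eq_lt_iff _ _ |>.2 (h.2.1 h1)]
    · rw [cmp_eq_eq_iff _ _ |>.2 h1, cmp_eq_eq_iff _ _ |>.2 (((hT p hp).eq_iff hq).1 h1.symm).symm]
    · rw [cmp_eq_gt_iff _ _ |>.2 h1, cmp_eq_gt_iff _ _ |>.2 (h.1.1 h1)]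
  obtain ⟨y, hy⟩ := Order.PartialIso.exists_across (⟨T, hcmp⟩ : Order.PartialIso ℝ ℝ) x
  refine ⟨y, fun t ht => ?_⟩
  have h := hy t ht
  rw [← cmp_eq_lt_iff, ← cmp_eq_lt_iff, ← cmp_eq_gt_iff, ← cmp_eq_gt_iff, h]
  exact ⟨Iff.rfl, Iff.rfl⟩

theorem exists_max_below {T : Finset (ℝ × ℝ)} {x : ℝ} (h : ∃ t ∈ T, t.1 < x) :
    ∃ s ∈ T, s.1 < x ∧ ∀ t ∈ T, t.1 < x → t.1 ≤ s.1 := by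
  obtain ⟨t, ht, htx⟩ := h
  obtain ⟨s, hs, hmax⟩ := (T.filter (·.1 < x)).exists_max_image (·.1) ⟨t, by simp [ht, htx]⟩
  simp only [Finset.mem_filter] at hs hmax
  exact ⟨s, hs.1, hs.2, fun t ht htx => hmax t ⟨ht, htx⟩⟩

theorem exists_min_above {T : Finset (ℝ × ℝ)} {x : ℝ} (h : ∃ t ∈ T, x < t.1) :
    ∃ s ∈ T, x < s.1 ∧ ∀ t ∈ T, x < t.1 → s.1 ≤ t.1 := by
  obtain ⟨t, ht, htx⟩ := h
  obtain ⟨s, hs, hmin⟩ := (T.filter (x < ·.1)).exists_min_image (·.1) ⟨t, by simp [ht, htx]⟩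
  simp only [Finset.mem_filter] at hs hmin
  exact ⟨s, hs.1, hs.2, fun t ht htx => hmin t ⟨ht, htx⟩⟩

/-! ### Signs and roots of real polynomials, and their matching. -/

theorem sign_eval_eq_of_forall_ne_zero {P : ℝ[X]} {u v : ℝ}
    (h : ∀ z ∈ uIcc u v, P.eval z ≠ 0) : SignType.sign (P.eval u) = SignType.sign (P.eval v) := by
  by_contra hne
  have h0 : (0 : ℝ) ∈ uIcc (P.eval u) (P.eval v) := by
    rw [mem_uIcc]
    have hu := h u left_mem_uIcc
    have hv := h v right_mem_uIcc
    rcases hu.lt_or_gt with hu | hu <;> rcases hv.lt_or_gt with hv | hv <;>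
      simp_all [sign_neg, sign_pos, le_of_lt]
  obtain ⟨z, hz, hz0⟩ := intermediate_value_uIcc P.continuous.continuousOn h0
  exact h z hz hz0

theorem exists_derivative_root {P : ℝ[X]} {u v : ℝ} (huv : u < v) (h : P.eval u = P.eval v) :
    ∃ z ∈ Ioo u v, P.derivative.eval z = 0 := by
  obtain ⟨z, hz, hz0⟩ := exists_deriv_eq_zero huv P.continuous.continuousOn h
  exact ⟨z, hz, by rwa [Polynomial.deriv] at hz0⟩

/-- The signs of `P` and `Q` agree at corresponding positions, and the points of `T` comprise the
real roots of `P` (first coordinates) and of `Q` (second coordinates). -/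
structure Matches (T : Finset (ℝ × ℝ)) (P Q : ℝ[X]) : Prop where
  sign_eq : ∀ x y, SamePosition T x y → SignType.sign (P.eval x) = SignType.sign (Q.eval y)
  left : P ≠ 0 → ∀ x, P.eval x = 0 → ∃ t ∈ T, t.1 = x
  right : Q ≠ 0 → ∀ y, Q.eval y = 0 → ∃ t ∈ T, t.2 = y

theorem Matches.mono {T T' : Finset (ℝ × ℝ)} (h : T ⊆ T') {P Q : ℝ[X]} (hPQ : Matches T P Q) :
    Matches T' P Q where
  sign_eq x y hxy := hPQ.sign_eq x y (hxy.mono h)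
  left h0 x hx := (hPQ.left h0 x hx).imp fun _ ht => ⟨h ht.1, ht.2⟩
  right h0 x hx := (hPQ.right h0 x hx).imp fun _ ht => ⟨h ht.1, ht.2⟩

theorem eval_eq_zero_iff_of_sign_eq {u v : ℝ} (h : SignType.sign u = SignType.sign v) :
    u = 0 ↔ v = 0 := by
  rw [← sign_eq_zero_iff, h, sign_eq_zero_iff]

/-- Only those points of `T` that are roots of members of a matched family are needed. -/
theorem exists_restrict {T : Finset (ℝ × ℝ)} (hT : IsPartialIso T) {L : Set (ℝ[X] × ℝ[X])}
    (hL : ∀ c ∈ L, Matches T c.1 c.2) (h0 : ∀ c ∈ L, c.1 = 0 ↔ c.2 = 0) :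
    ∃ T₀ ⊆ T, (∀ c ∈ L, Matches T₀ c.1 c.2) ∧
      ∀ t ∈ T₀, ∃ c ∈ L, c.1 ≠ 0 ∧ c.1.eval t.1 = 0 := by
  classical
  let T₀ := T.filter fun t => ∃ c ∈ L, c.1 ≠ 0 ∧ c.1.eval t.1 = 0
  have hsub : T₀ ⊆ T := Finset.filter_subset _ _
  have hright : ∀ c ∈ L, c.2 ≠ 0 → ∀ y, c.2.eval y = 0 → ∃ t ∈ T₀, t.2 = y := by
    intro c hc hc0 y hy
    obtain ⟨t, ht, rfl⟩ := (hL c hc).right hc0 y hy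
    refine ⟨t, Finset.mem_filter.2 ⟨ht, c, hc, (h0 c hc).not.2 hc0, ?_⟩, rfl⟩
    exact (eval_eq_zero_iff_of_sign_eq ((hL c hc).sign_eq _ _ (hT t ht))).2 hy
  refine ⟨T₀, hsub, fun c hc => ⟨fun x y hxy => ?_, fun hc0 x hx => ?_, hright c hc⟩,
    fun t ht => (Finset.mem_filter.1 ht).2⟩
  · by_cases hc0 : c.2 = 0
    · simp [hc0, (h0 c hc).2 hc0]
    obtain ⟨y₀, hy₀⟩ := hT.exists_samePosition x
    rw [(hL c hc).sign_eq x y₀ hy₀]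
    by_cases hy : y₀ = y
    · rw [hy]
    -- Both y and y₀ have the position of x relative to T₀, and T₀ holds every root of `c.2`; hence
    -- no root lies between them.
    apply sign_eval_eq_of_forall_ne_zero
    intro z hz hz0
    obtain ⟨t, ht, rfl⟩ := hright c hc hc0 z hz0
    have h1 := hxy t ht
    have h2 := hy₀.mono hsub t ht
    rw [mem_uIcc] at hz
    grind
  · obtain ⟨t, ht, rfl⟩ := (hL c hc).left hc0 x hx
    exact ⟨t, Finset.mem_filter.2 ⟨ht, c, hc, hc0, hx⟩, rfl⟩

/-! ### Signs near ±∞. -/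

theorem eventually_sign_eval_eq {P : ℝ[X]} (hP : 0 < P.natDegree) :
    ∀ᶠ x in Filter.atTop, SignType.sign (P.eval x) = SignType.sign P.leadingCoeff := by
  have h0 : P.leadingCoeff ≠ 0 := by
    rw [Ne, leadingCoeff_eq_zero]
    rintro rfl
    simp at hP
  rcases h0.lt_or_gt with h | h
  · filter_upwards [(P.tendsto_atBot_of_leadingCoeff_nonpos (natDegree_pos_iff_degree_pos.1 hP)
      h.le).eventually_lt_atBot 0] with x hx
    rw [sign_neg hx, sign_neg h]
  · filter_upwards [(P.tendsto_atTop_of_leadingCoeff_nonneg (natDegree_pos_iff_degree_pos.1 hP)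
      h.le).eventually_gt_atTop 0] with x hx
    rw [sign_pos hx, sign_pos h]

theorem eventually_sign_eval_eq_sign_eval {P Q : ℝ[X]} (hP : 0 < P.natDegree)
    (hPQ : P.natDegree = Q.natDegree)
    (hlead : SignType.sign P.leadingCoeff = SignType.sign Q.leadingCoeff) :
    ∀ᶠ B in Filter.atTop, ∀ x ≥ B, ∀ y ≥ B,
      SignType.sign (P.eval x) = SignType.sign (Q.eval y) := by
  obtain ⟨B, hB⟩ := Filter.eventually_atTop.1
    ((eventually_sign_eval_eq hP).and (eventually_sign_eval_eq (hPQ ▸ hP)))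
  filter_upwards [Filter.eventually_ge_atTop B] with C hC x hx y hy
  rw [(hB x (hC.trans hx)).1, (hB y (hC.trans hy)).2, hlead]

theorem eventually_sign_eval_eq_sign_eval_neg {P Q : ℝ[X]} (hP : 0 < P.natDegree)
    (hPQ : P.natDegree = Q.natDegree)
    (hlead : SignType.sign P.leadingCoeff = SignType.sign Q.leadingCoeff) :
    ∀ᶠ B in Filter.atTop, ∀ x ≤ -B, ∀ y ≤ -B,
      SignType.sign (P.eval x) = SignType.sign (Q.eval y) := by
  have hd (R : ℝ[X]) : (R.comp (-X)).natDegree = R.natDegree := by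
    simp [natDegree_comp]
  have hl (R : ℝ[X]) : (R.comp (-X)).leadingCoeff = R.leadingCoeff * (-1) ^ R.natDegree := by
    rw [leadingCoeff_comp (by simp)]
    simp
  -- Reflection in 0 multiplies both leading coefficients by the same power of -1, because the
  -- degrees agree.
  have := eventually_sign_eval_eq_sign_eval (P := P.comp (-X)) (Q := Q.comp (-X))
    (by rwa [hd]) (by rw [hd, hd, hPQ]) (by rw [hl, hl, sign_mul, sign_mul, hPQ, hlead])
  filter_upwards [this] with B hB x hx y hy
  simpa using hB (-x) (by linarith) (-y) (by linarith)

/-! ### From critical points to roots. -/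

/-- A pairing of points on which two polynomials have equal signs, which includes the critical
points of both and such that the polynomials have equal signs beyond it. -/
structure IsCriticalPairing (T : Finset (ℝ × ℝ)) (P Q : ℝ[X]) : Prop where
  iso : IsPartialIso T
  sign_eq : ∀ t ∈ T, SignType.sign (P.eval t.1) = SignType.sign (Q.eval t.2)
  left : ∀ x, P.derivative.eval x = 0 → ∃ t ∈ T, t.1 = x
  right : ∀ y, Q.derivative.eval y = 0 → ∃ t ∈ T, t.2 = y
  above : ∀ x y, SamePosition T x y → (∀ t ∈ T, t.1 < x) →
    SignType.sign (P.eval x) = SignType.sign (Q.eval y)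
  below : ∀ x y, SamePosition T x y → (∀ t ∈ T, x < t.1) →
    SignType.sign (P.eval x) = SignType.sign (Q.eval y)

theorem IsCriticalPairing.swap {T : Finset (ℝ × ℝ)} {P Q : ℝ[X]} (h : IsCriticalPairing T P Q) :
    IsCriticalPairing (T.image Prod.swap) Q P where
  iso := h.iso.swap
  sign_eq t ht := by
    obtain ⟨s, hs, rfl⟩ := Finset.mem_image.1 ht
    exact (h.sign_eq s hs).symm
  left y hy := by
    obtain ⟨t, ht, rfl⟩ := h.right y hy
    exact ⟨t.swap, Finset.mem_image_of_mem _ ht, rfl⟩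
  right y hy := by
    obtain ⟨t, ht, rfl⟩ := h.left y hy
    exact ⟨t.swap, Finset.mem_image_of_mem _ ht, rfl⟩
  above x y hxy hx := by
    have hyx := samePosition_of_swap hxy
    exact (h.above y x hyx fun t ht =>
      (hyx t ht).1.2 (hx t.swap (Finset.mem_image_of_mem _ ht))).symm
  below x y hxy hx := by
    have hyx := samePosition_of_swap hxy
    exact (h.below y x hyx fun t ht =>
      (hyx t ht).2.2 (hx t.swap (Finset.mem_image_of_mem _ ht))).symm

/-- A root in a gap between neighbouring points of T is a strict sign change, since P is strictly
monotone on a gap free of critical points. The paired endpoints give Q the same opposite signs, and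
the intermediate value theorem applies. In the two unbounded gaps the prescribed equality of signs
leaves P no root that Q lacks. -/
theorem IsCriticalPairing.exists_root {T : Finset (ℝ × ℝ)} {P Q : ℝ[X]}
    (h : IsCriticalPairing T P Q) {x : ℝ} (hx : P.eval x = 0) :
    ∃ y, SamePosition T x y ∧ Q.eval y = 0 := by
  by_cases hmem : ∃ t ∈ T, t.1 = x
  · obtain ⟨t, ht, rfl⟩ := hmem
    exact ⟨t.2, h.iso t ht, (eval_eq_zero_iff_of_sign_eq (h.sign_eq t ht)).1 hx⟩
  have hne : ∀ t ∈ T, t.1 ≠ x := fun t ht he => hmem ⟨t, ht, he⟩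
  by_cases hbelow : ∃ t ∈ T, t.1 < x
  swap
  · obtain ⟨y, hy⟩ := h.iso.exists_samePosition x
    refine ⟨y, hy, (eval_eq_zero_iff_of_sign_eq (h.below x y hy fun t ht => ?_)).1 hx⟩
    exact lt_of_le_of_ne (not_lt.1 fun hlt => hbelow ⟨t, ht, hlt⟩) (hne t ht).symm
  by_cases habove : ∃ t ∈ T, x < t.1
  swap
  · obtain ⟨y, hy⟩ := h.iso.exists_samePosition x
    refine ⟨y, hy, (eval_eq_zero_iff_of_sign_eq (h.above x y hy fun t ht => ?_)).1 hx⟩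
    exact lt_of_le_of_ne (not_lt.1 fun hlt => habove ⟨t, ht, hlt⟩) (hne t ht)
  obtain ⟨s, hs, hsx, hsmax⟩ := exists_max_below hbelow
  obtain ⟨u, hu, hxu, humin⟩ := exists_min_above habove
  have hinj : InjOn (fun z => P.eval z) (Icc s.1 u.1) := by
    have key : ∀ v ∈ Icc s.1 u.1, ∀ w ∈ Icc s.1 u.1, v < w → P.eval v ≠ P.eval w := by
      intro v hv w hw hvw he
      obtain ⟨z, hz, hz0⟩ := exists_derivative_root hvw he
      obtain ⟨t, ht, rfl⟩ := h.left z hz0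
      have h1 : s.1 < t.1 := hv.1.trans_lt hz.1
      have h2 : t.1 < u.1 := hz.2.trans_le hw.2
      rcases (hne t ht).lt_or_gt with h3 | h3
      · exact absurd (hsmax t ht h3) (not_le.2 h1)
      · exact absurd (humin t ht h3) (not_le.2 h2)
    intro v hv w hw he
    rcases lt_trichotomy v w with hvw | hvw | hvw
    · exact absurd he (key v hv w hw hvw)
    · exact hvw
    · exact absurd he.symm (key w hw v hv hvw)
  have hsu : s.2 < u.2 := (h.iso u hu s hs).1.1 (hsx.trans hxu)
  have hpos : ∀ y ∈ Ioo s.2 u.2, SamePosition T x y := by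
    intro y hy t ht
    have h1 := h.iso s hs t ht
    have h2 := h.iso u hu t ht
    have h3 := hy.1
    have h4 := hy.2
    rcases (hne t ht).lt_or_gt with h5 | h5
    · have := hsmax t ht h5
      grind
    · have := humin t ht h5
      grind
  have hs' := h.sign_eq s hs
  have hu' := h.sign_eq u hu
  have hsI : s.1 ∈ Icc s.1 u.1 := ⟨le_rfl, (hsx.trans hxu).le⟩
  have huI : u.1 ∈ Icc s.1 u.1 := ⟨(hsx.trans hxu).le, le_rfl⟩
  have hxI : x ∈ Icc s.1 u.1 := ⟨hsx.le, hxu.le⟩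
  rcases P.continuous.continuousOn.strictMonoOn_of_injOn_Icc' (hsx.trans hxu).le hinj
    with hm | hm
  · have h1 : P.eval s.1 < 0 := hx ▸ hm hsI hxI hsx
    have h2 : 0 < P.eval u.1 := hx ▸ hm hxI huI hxu
    rw [sign_neg h1, eq_comm, sign_eq_neg_one_iff] at hs'
    rw [sign_pos h2, eq_comm, sign_eq_one_iff] at hu'
    obtain ⟨y, hy, hy0⟩ := intermediate_value_Ioo hsu.le Q.continuous.continuousOn ⟨hs', hu'⟩
    exact ⟨y, hpos y hy, hy0⟩
  · have h1 : 0 < P.eval s.1 := hx ▸ hm hsI hxI hsx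
    have h2 : P.eval u.1 < 0 := hx ▸ hm hxI huI hxu
    rw [sign_pos h1, eq_comm, sign_eq_one_iff] at hs'
    rw [sign_neg h2, eq_comm, sign_eq_neg_one_iff] at hu'
    obtain ⟨y, hy, hy0⟩ := intermediate_value_Ioo' hsu.le Q.continuous.continuousOn ⟨hu', hs'⟩
    exact ⟨y, hpos y hy, hy0⟩

/-- If a pairing contains all roots, positions adjacent to a non-root inherit its sign. -/
theorem sign_eq_of_adjacent {T : Finset (ℝ × ℝ)} {P Q : ℝ[X]} {x y : ℝ} {s : ℝ × ℝ}
    (hs : s ∈ T) (hiso : IsPartialIso T) (hxy : SamePosition T x y)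
    (hsgn : SignType.sign (P.eval s.1) = SignType.sign (Q.eval s.2)) (hs0 : P.eval s.1 ≠ 0)
    (hP : ∀ z, P.eval z = 0 → ∃ t ∈ T, t.1 = z) (hQ : ∀ z, Q.eval z = 0 → ∃ t ∈ T, t.2 = z)
    (hadj : ∀ t ∈ T, t.1 ∈ uIcc s.1 x → t.1 = s.1) :
    SignType.sign (P.eval x) = SignType.sign (Q.eval y) := by
  rw [← sign_eval_eq_of_forall_ne_zero (u := s.1) (v := x),
    ← sign_eval_eq_of_forall_ne_zero (u := s.2) (v := y), hsgn]
  · intro z hz hz0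
    obtain ⟨t, ht, rfl⟩ := hQ z hz0
    have h1 := hxy t ht
    have h2 := hiso s hs t ht
    have h3 : t.1 ∈ uIcc s.1 x := by
      rw [mem_uIcc] at hz ⊢
      grind
    have h4 := ((hiso s hs).eq_iff ht).1 (hadj t ht h3)
    rw [h4] at hz0
    exact hs0 ((eval_eq_zero_iff_of_sign_eq hsgn).2 hz0)
  · intro z hz hz0
    obtain ⟨t, ht, rfl⟩ := hP z hz0
    rw [hadj t ht hz] at hz0
    exact hs0 hz0

/-- T is enlarged by all pairs of roots of P and Q in the same position relative to T. By Rolle, two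
distinct roots of one polynomial are separated by a critical point, which belongs to T; so the order
of the roots on one side forces that on the other. -/
theorem IsCriticalPairing.exists_matches {T : Finset (ℝ × ℝ)} {P Q : ℝ[X]}
    (h : IsCriticalPairing T P Q) (hP : P ≠ 0) (hQ : Q ≠ 0) :
    ∃ T', T ⊆ T' ∧ IsPartialIso T' ∧ Matches T' P Q := by
  classical
  let R := (P.roots.toFinset ×ˢ Q.roots.toFinset).filter fun t => SamePosition T t.1 t.2
  have hR : ∀ t, t ∈ R ↔ (P.eval t.1 = 0 ∧ Q.eval t.2 = 0) ∧ SamePosition T t.1 t.2 := by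
    intro t
    simp [R, hP, hQ]
  have hpos : ∀ t ∈ T ∪ R, SamePosition T t.1 t.2 := by
    intro t ht
    rcases Finset.mem_union.1 ht with ht | ht
    · exact h.iso t ht
    · exact ((hR t).1 ht).2
  have hlt : ∀ t ∈ R, ∀ s ∈ R, t.1 < s.1 ↔ t.2 < s.2 := by
    intro t ht s hs
    rw [hR] at ht hs
    constructor
    · intro hlt
      obtain ⟨z, hz, hz0⟩ := exists_derivative_root hlt (ht.1.1.trans hs.1.1.symm)
      obtain ⟨u, hu, rfl⟩ := h.left z hz0
      exact ((ht.2 u hu).2.1 hz.1).trans ((hs.2 u hu).1.1 hz.2)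
    · intro hlt
      obtain ⟨z, hz, hz0⟩ := exists_derivative_root hlt (ht.1.2.trans hs.1.2.symm)
      obtain ⟨u, hu, rfl⟩ := h.right z hz0
      exact ((ht.2 u hu).2.2 hz.1).trans ((hs.2 u hu).1.2 hz.2)
  have hiso : IsPartialIso (T ∪ R) := by
    intro t ht s hs
    rcases Finset.mem_union.1 hs with hs' | hs'
    · exact hpos t ht s hs'
    rcases Finset.mem_union.1 ht with ht' | ht'
    · have := hpos s hs t ht'
      exact ⟨this.2, this.1⟩
    · exact ⟨hlt s hs' t ht', hlt t ht' s hs'⟩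
  have hsgn : ∀ t ∈ T ∪ R, SignType.sign (P.eval t.1) = SignType.sign (Q.eval t.2) := by
    intro t ht
    rcases Finset.mem_union.1 ht with ht | ht
    · exact h.sign_eq t ht
    · rw [((hR t).1 ht).1.1, ((hR t).1 ht).1.2]
  have hleft : ∀ x, P.eval x = 0 → ∃ t ∈ T ∪ R, t.1 = x := by
    intro x hx
    obtain ⟨y, hxy, hy⟩ := h.exists_root hx
    exact ⟨(x, y), Finset.mem_union_right _ ((hR _).2 ⟨⟨hx, hy⟩, hxy⟩), rfl⟩
  have hright : ∀ y, Q.eval y = 0 → ∃ t ∈ T ∪ R, t.2 = y := by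
    intro y hy
    obtain ⟨x, hxy, hx⟩ := h.swap.exists_root hy
    exact ⟨(x, y), Finset.mem_union_right _ ((hR _).2 ⟨⟨hx, hy⟩, samePosition_of_swap hxy⟩), rfl⟩
  refine ⟨T ∪ R, Finset.subset_union_left, hiso, fun x y hxy => ?_, fun _ => hleft,
    fun _ => hright⟩
  by_cases hmem : ∃ t ∈ T ∪ R, t.1 = x
  · obtain ⟨t, ht, rfl⟩ := hmem
    rw [hsgn t ht, (hxy.eq_iff ht).1 rfl]
  have hne : ∀ t ∈ T ∪ R, t.1 ≠ x := fun t ht he => hmem ⟨t, ht, he⟩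
  have hxyT := hxy.mono (Finset.subset_union_left (s₁ := T) (s₂ := R))
  by_cases hbelow : ∃ t ∈ T ∪ R, t.1 < x
  swap
  · refine h.below x y hxyT fun t ht => ?_
    have ht' := Finset.mem_union_left R ht
    exact lt_of_le_of_ne (not_lt.1 fun hlt => hbelow ⟨t, ht', hlt⟩) (hne t ht').symm
  by_cases habove : ∃ t ∈ T ∪ R, x < t.1
  swap
  · refine h.above x y hxyT fun t ht => ?_
    have ht' := Finset.mem_union_left R ht
    exact lt_of_le_of_ne (not_lt.1 fun hlt => habove ⟨t, ht', hlt⟩) (hne t ht')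
  obtain ⟨s, hs, hsx, hsmax⟩ := exists_max_below hbelow
  obtain ⟨u, hu, hxu, humin⟩ := exists_min_above habove
  -- Two neighbouring points cannot both be roots of P, by Rolle. The endpoint that is not a root
  -- determines the sign throughout the gap.
  by_cases hs0 : P.eval s.1 = 0
  · by_cases hu0 : P.eval u.1 = 0
    · obtain ⟨z, hz, hz0⟩ := exists_derivative_root (hsx.trans hxu) (hs0.trans hu0.symm)
      obtain ⟨t, ht, rfl⟩ := h.left z hz0
      have ht' := Finset.mem_union_left R ht
      rcases (hne t ht').lt_or_gt with h3 | h3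
      · exact absurd (hsmax t ht' h3) (not_le.2 hz.1)
      · exact absurd (humin t ht' h3) (not_le.2 hz.2)
    · refine sign_eq_of_adjacent hu hiso hxy (hsgn u hu) hu0 hleft hright fun t ht htm => ?_
      rw [uIcc_of_ge hxu.le] at htm
      exact le_antisymm htm.2 (humin t ht (lt_of_le_of_ne htm.1 (hne t ht).symm))
  · refine sign_eq_of_adjacent hs hiso hxy (hsgn s hs) hs0 hleft hright fun t ht htm => ?_
    rw [uIcc_of_le hsx.le] at htm
    exact le_antisymm (hsmax t ht (lt_of_le_of_ne htm.2 (hne t ht))) htm.1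

/-- A pairing that contains the critical points extends to one that matches the polynomials. -/
theorem exists_matches_of_critical {T : Finset (ℝ × ℝ)} (hT : IsPartialIso T) {P Q : ℝ[X]}
    (hsgn : ∀ t ∈ T, SignType.sign (P.eval t.1) = SignType.sign (Q.eval t.2))
    (hleft : ∀ x, P.derivative.eval x = 0 → ∃ t ∈ T, t.1 = x)
    (hright : ∀ y, Q.derivative.eval y = 0 → ∃ t ∈ T, t.2 = y)
    (hP : 0 < P.natDegree) (hPQ : P.natDegree = Q.natDegree)
    (hlead : SignType.sign P.leadingCoeff = SignType.sign Q.leadingCoeff) :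
    ∃ T', T ⊆ T' ∧ IsPartialIso T' ∧ Matches T' P Q := by
  classical
  have hbd : ∀ᶠ B : ℝ in Filter.atTop, ∀ t ∈ T, |t.1| < B ∧ |t.2| < B := by
    rw [Filter.eventually_all_finset]
    intro t _
    exact (Filter.eventually_gt_atTop _).and (Filter.eventually_gt_atTop _)
  obtain ⟨B, ⟨⟨h1, h2⟩, h3⟩, hB⟩ := (((eventually_sign_eval_eq_sign_eval hP hPQ hlead).and
    (eventually_sign_eval_eq_sign_eval_neg hP hPQ hlead)).and hbd).and
    (Filter.eventually_gt_atTop 0) |>.exists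
  -- The sentinels ±B lie outside all points of T. Anything beyond them is in the range where
  -- leading coefficients decide the signs, on both sides at once.
  let T₁ := insert (B, B) (insert (-B, -B) T)
  have hsub : T ⊆ T₁ := fun t ht => by simp [T₁, ht]
  have hBm : (B, B) ∈ T₁ := by simp [T₁]
  have hBm' : (-B, -B) ∈ T₁ := by simp [T₁]
  have hcrit : IsCriticalPairing T₁ P Q := by
    refine ⟨?_, ?_, ?_, ?_, ?_, ?_⟩
    · intro t ht s hs
      simp only [T₁, Finset.mem_insert] at ht hs
      simp only [abs_lt] at h3
      rcases ht with rfl | rfl | ht <;> rcases hs with rfl | rfl | hs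
      · simp
      · simp
      · have := h3 s hs
        grind
      · simp
      · simp
      · have := h3 s hs
        grind
      · have := h3 t ht
        grind
      · have := h3 t ht
        grind
      · exact hT t ht s hs
    · intro t ht
      simp only [T₁, Finset.mem_insert] at ht
      rcases ht with rfl | rfl | ht
      · exact h1 B le_rfl B le_rfl
      · exact h2 (-B) le_rfl (-B) le_rfl
      · exact hsgn t ht
    · exact fun x hx => (hleft x hx).imp fun t ht => ⟨hsub ht.1, ht.2⟩
    · exact fun x hx => (hright x hx).imp fun t ht => ⟨hsub ht.1, ht.2⟩
    · intro x y hxy hx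
      exact h1 x (hx _ hBm).le y ((hxy _ hBm).1.1 (hx _ hBm)).le
    · intro x y hxy hx
      exact h2 x (hx _ hBm').le y ((hxy _ hBm').2.1 (hx _ hBm')).le
  have hP0 : P ≠ 0 := by
    rintro rfl
    simp at hP
  have hQ0 : Q ≠ 0 := by
    rintro rfl
    simp [hPQ] at hP
  obtain ⟨T', hT', h⟩ := hcrit.exists_matches hP0 hQ0
  exact ⟨T', hsub.trans hT', h⟩

/-! ### Elimination of one variable, with parameter points as ring homomorphisms to ℝ. -/

section Elimination

variable {A : Type*} [CommRing A]

/-- The points `a` and `b` of `A` give equal signs to all members of `S`. -/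
def SignEq (S : Finset A) (a b : A →+* ℝ) : Prop :=
  ∀ s ∈ S, SignType.sign (a s) = SignType.sign (b s)

theorem SignEq.mono {S S' : Finset A} (h : S ⊆ S') {a b : A →+* ℝ} (hab : SignEq S' a b) :
    SignEq S a b :=
  fun s hs => hab s (h hs)

/-- The configuration of the real roots and signs of the family `L` depends only on the signs
of finitely many functions of the parameters. -/
def IsDetermined (L : Finset A[X]) : Prop :=
  ∃ S : Finset A, ∀ a b : A →+* ℝ, SignEq S a b →
    ∃ T, IsPartialIso T ∧ ∀ p ∈ L, Matches T (p.map a) (p.map b)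

theorem IsDetermined.mono {L M : Finset A[X]} (h : L ⊆ M) (hM : IsDetermined M) :
    IsDetermined L := by
  obtain ⟨S, hS⟩ := hM
  refine ⟨S, fun a b hab => ?_⟩
  obtain ⟨T, hT, hTM⟩ := hS a b hab
  exact ⟨T, hT, fun p hp => hTM p (h hp)⟩

/-- The part of `p` of degree less than `d`. -/
noncomputable def truncate (d : ℕ) (p : A[X]) : A[X] :=
  ∑ i ∈ Finset.range d, C (p.coeff i) * X ^ i

theorem coeff_truncate (d : ℕ) (p : A[X]) (i : ℕ) :
    (truncate d p).coeff i = if i < d then p.coeff i else 0 := by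
  simp [truncate, coeff_X_pow]

theorem natDegree_truncate_lt {d : ℕ} (hd : 0 < d) (p : A[X]) : (truncate d p).natDegree < d := by
  have : (truncate d p).natDegree ≤ d - 1 := by
    rw [natDegree_le_iff_coeff_eq_zero]
    intro i hi
    rw [coeff_truncate, if_neg (by omega)]
  omega

theorem map_truncate {d : ℕ} {p : A[X]} {a : A →+* ℝ}
    (h : ∀ i, d ≤ i → a (p.coeff i) = 0) : (truncate d p).map a = p.map a := by
  ext i
  rw [coeff_map, coeff_truncate, coeff_map]
  split_ifs with hi
  · rfl
  · rw [map_zero, h i (not_lt.1 hi)]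

/-- One step of the pseudo-division of `p`, of formal degree `d`, by `q`, of formal degree `e`. -/
noncomputable def reduction (d : ℕ) (p : A[X]) (e : ℕ) (q : A[X]) : A[X] :=
  truncate d (C (q.coeff e ^ 2) * p - C (q.coeff e * p.coeff d) * X ^ (d - e) * q)

/-- The truncation loses nothing after specialization: the terms of degree d cancel, and those of
higher degree vanish. Here e is the degree of the specialized q, which may be smaller than the
formal one. -/
theorem map_reduction {d e : ℕ} {p q : A[X]} (hp : p.natDegree ≤ d) {a : A →+* ℝ}
    (hq : (q.map a).natDegree = e) (hed : e ≤ d) :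
    (reduction d p e q).map a =
      C (a (q.coeff e) ^ 2) * p.map a
        - C (a (q.coeff e) * a (p.coeff d)) * X ^ (d - e) * q.map a := by
  rw [reduction, map_truncate]
  · simp
  intro i hi
  rw [← coeff_map]
  simp only [Polynomial.map_sub, Polynomial.map_mul, map_C, Polynomial.map_pow, map_X, map_pow,
    map_mul, coeff_sub]
  rw [← C_pow, ← C_mul, coeff_C_mul, mul_assoc, coeff_C_mul, coeff_X_pow_mul', if_pos (by omega)]
  rcases hi.eq_or_lt with rfl | hi
  · rw [Nat.sub_sub_self hed]
    simp only [coeff_map]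
    ring
  · rw [coeff_map, coeff_eq_zero_of_natDegree_lt (hp.trans_lt hi),
      coeff_eq_zero_of_natDegree_lt (p := q.map a) (by omega)]
    simp

/-- At a root of q the reduction equals p times the square of the nonzero leading coefficient of q.
The square in the definition of `reduction` is there to keep the sign. -/
theorem sign_eval_reduction {d e : ℕ} {p q : A[X]} (hp : p.natDegree ≤ d) {a : A →+* ℝ}
    (hq : (q.map a).natDegree = e) (hed : e ≤ d) (hq0 : q.map a ≠ 0) {x : ℝ}
    (hx : (q.map a).eval x = 0) :
    SignType.sign (((reduction d p e q).map a).eval x) =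
      SignType.sign ((p.map a).eval x) := by
  have h : a (q.coeff e) ≠ 0 := by
    rw [← coeff_map, ← hq]
    exact leadingCoeff_ne_zero.2 hq0
  rw [map_reduction hp hq hed]
  simp only [eval_sub, eval_mul, eval_C, hx, mul_zero, sub_zero]
  rw [sign_mul, sign_pos (by positivity), one_mul]

open Classical in
/-- The coefficients of the members of `L`. -/
noncomputable def coefficients (L : Finset A[X]) : Finset A :=
  L.biUnion fun p => p.support.image p.coeff

theorem SignEq.sign_coeff {L : Finset A[X]} {a b : A →+* ℝ} (h : SignEq (coefficients L) a b)
    {p : A[X]} (hp : p ∈ L) (i : ℕ) :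
    SignType.sign ((p.map a).coeff i) = SignType.sign ((p.map b).coeff i) := by
  classical
  rw [coeff_map, coeff_map]
  by_cases hi : p.coeff i = 0
  · simp [hi]
  · exact h _ (Finset.mem_biUnion.2 ⟨p, hp, Finset.mem_image.2 ⟨i, mem_support_iff.2 hi, rfl⟩⟩)

theorem SignEq.support_eq {L : Finset A[X]} {a b : A →+* ℝ} (h : SignEq (coefficients L) a b)
    {p : A[X]} (hp : p ∈ L) : (p.map a).support = (p.map b).support := by
  ext i
  rw [mem_support_iff, mem_support_iff]
  exact (eval_eq_zero_iff_of_sign_eq (h.sign_coeff hp i)).not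

theorem SignEq.natDegree_eq {L : Finset A[X]} {a b : A →+* ℝ} (h : SignEq (coefficients L) a b)
    {p : A[X]} (hp : p ∈ L) : (p.map a).natDegree = (p.map b).natDegree := by
  rw [natDegree, natDegree, degree, degree, h.support_eq hp]

theorem SignEq.eq_zero_iff {L : Finset A[X]} {a b : A →+* ℝ} (h : SignEq (coefficients L) a b)
    {p : A[X]} (hp : p ∈ L) : p.map a = 0 ↔ p.map b = 0 := by
  rw [← support_eq_empty, h.support_eq hp, support_eq_empty]

open Classical in
/-- The polynomials of lower degree that govern the adjunction of `p` to the family `L`. -/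
noncomputable def reductions (d : ℕ) (p : A[X]) (L : Finset A[X]) : Finset A[X] :=
  insert (truncate d p) (((Finset.range (d + 1)) ×ˢ insert (derivative p) L).image
    fun c => reduction d p c.1 c.2)

theorem natDegree_lt_of_mem_reductions {d : ℕ} (hd : 0 < d) {p r : A[X]} {L : Finset A[X]}
    (hr : r ∈ reductions d p L) : r.natDegree < d := by
  simp only [reductions, Finset.mem_insert, Finset.mem_image] at hr
  rcases hr with rfl | ⟨c, -, rfl⟩
  · exact natDegree_truncate_lt hd _
  · exact natDegree_truncate_lt hd _

-- If the coefficient of degree d vanishes, p specializes to its truncation, which is already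
-- matched. Otherwise the roots of p' and of L serve as a critical pairing: the reductions give the
-- signs of p there, and p is inserted between them. Reductions are taken for every e ≤ d because
-- the degree of q drops at some parameters.
open Classical in
theorem IsDetermined.insert_of_reductions {d : ℕ} (hd : 0 < d) {p : A[X]} (hp : p.natDegree ≤ d)
    {L : Finset A[X]} (hL : ∀ q ∈ L, q.natDegree ≤ d)
    (h : IsDetermined (insert (derivative p) L ∪ reductions d p L)) :
    IsDetermined (insert p L) := by
  obtain ⟨S, hS⟩ := h
  set L₁ := insert (derivative p) L with hL₁
  refine ⟨S ∪ coefficients (insert p L₁), fun a b hab => ?_⟩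
  obtain ⟨T, hT, hTM⟩ := hS a b (hab.mono Finset.subset_union_left)
  replace hab := hab.mono (Finset.subset_union_right (s₁ := S))
  have hpmem : p ∈ insert p L₁ := Finset.mem_insert_self _ _
  have hsub : ∀ q ∈ L₁, q ∈ insert p L₁ := fun q hq => Finset.mem_insert_of_mem hq
  by_cases hpd : a (p.coeff d) = 0
  · refine ⟨T, hT, fun q hq => ?_⟩
    rcases Finset.mem_insert.1 hq with rfl | hq
    · have htr : ∀ c : A →+* ℝ, c (q.coeff d) = 0 → (truncate d q).map c = q.map c := by
        intro c hc
        refine map_truncate fun i hi => ?_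
        rcases hi.eq_or_lt with rfl | hi
        · exact hc
        · rw [coeff_eq_zero_of_natDegree_lt (hp.trans_lt hi), map_zero]
      have hpd' : b (q.coeff d) = 0 := by
        have := eval_eq_zero_iff_of_sign_eq (hab.sign_coeff hpmem d)
        rw [coeff_map, coeff_map] at this
        exact this.1 hpd
      have := hTM (truncate d q) (by simp [reductions])
      rwa [htr a hpd, htr b hpd'] at this
    · exact hTM q (by simp [hL₁, hq])
  have hdeg : (p.map a).natDegree = d := by
    refine le_antisymm (natDegree_map_le.trans hp) (le_natDegree_of_ne_zero ?_)
    rwa [coeff_map]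
  have hdeg' : (p.map b).natDegree = d := by rw [← hab.natDegree_eq hpmem, hdeg]
  have hL₁d : ∀ q ∈ L₁, q.natDegree ≤ d := by
    intro q hq
    rcases Finset.mem_insert.1 hq with rfl | hq
    · exact (natDegree_derivative_le p).trans (by omega)
    · exact hL q hq
  -- T also contains roots of the reductions themselves, where the sign of p is not controlled. Only
  -- roots of members of `L₁` are kept.
  obtain ⟨T₀, hT₀, hmatch, hroots⟩ := exists_restrict hT
    (L := {c | ∃ q ∈ L₁, c = (q.map a, q.map b)})
    (by
      rintro _ ⟨q, hq, rfl⟩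
      exact hTM q (Finset.mem_union_left _ hq))
    (by
      rintro _ ⟨q, hq, rfl⟩
      exact hab.eq_zero_iff (hsub q hq))
  have hmatch' : ∀ q ∈ L₁, Matches T₀ (q.map a) (q.map b) := fun q hq => hmatch _ ⟨q, hq, rfl⟩
  have hderiv := hmatch' (derivative p) (Finset.mem_insert_self _ _)
  have hder0 : ∀ P : ℝ[X], P.natDegree = d → derivative P ≠ 0 := by
    intro P hP h0
    have := derivative_eq_zero.1 h0
    omega
  have hsgn : ∀ t ∈ T₀,
      SignType.sign ((p.map a).eval t.1) = SignType.sign ((p.map b).eval t.2) := by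
    intro t ht
    obtain ⟨_, ⟨q, hq, rfl⟩, hq0, hqt⟩ := hroots t ht
    dsimp only at hq0 hqt
    have hqm := hsub q hq
    have hqt' : (q.map b).eval t.2 = 0 :=
      (eval_eq_zero_iff_of_sign_eq ((hmatch' q hq).sign_eq _ _ (hT.mono hT₀ t ht))).1 hqt
    have hed : (q.map a).natDegree ≤ d := natDegree_map_le.trans (hL₁d q hq)
    rw [← sign_eval_reduction hp rfl hed hq0 hqt,
      ← sign_eval_reduction hp (hab.natDegree_eq hqm).symm hed
        ((hab.eq_zero_iff hqm).not.1 hq0) hqt']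
    refine (hTM _ (Finset.mem_union_right _ ?_)).sign_eq _ _ (hT t (hT₀ ht))
    refine Finset.mem_insert_of_mem (Finset.mem_image.2 ⟨((q.map a).natDegree, q), ?_, rfl⟩)
    exact Finset.mem_product.2 ⟨Finset.mem_range.2 (by omega), hq⟩
  have hlead : SignType.sign (p.map a).leadingCoeff = SignType.sign (p.map b).leadingCoeff := by
    rw [leadingCoeff, leadingCoeff, hdeg, hdeg']
    exact hab.sign_coeff hpmem d
  obtain ⟨T', hT', hiso, hp'⟩ := exists_matches_of_critical (hT.mono hT₀) hsgn
    (by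
      rw [derivative_map]
      exact hderiv.left (derivative_map p a ▸ hder0 _ hdeg))
    (by
      rw [derivative_map]
      exact hderiv.right (derivative_map p b ▸ hder0 _ hdeg'))
    (by omega) (by omega) hlead
  refine ⟨T', hiso, fun q hq => ?_⟩
  rcases Finset.mem_insert.1 hq with rfl | hq
  · exact hp'
  · exact (hmatch' q (Finset.mem_insert_of_mem hq)).mono hT'

theorem isDetermined_of_natDegree_eq_zero {L : Finset A[X]} (hL : ∀ p ∈ L, p.natDegree = 0) :
    IsDetermined L := by
  refine ⟨coefficients L, fun a b hab => ⟨∅, fun t ht => by simp at ht, fun p hp => ?_⟩⟩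
  have h0 := hab.sign_coeff hp 0
  have hz := hab.eq_zero_iff hp
  rw [eq_C_of_natDegree_eq_zero (hL p hp)] at hz ⊢
  simp only [map_C, coeff_map] at h0 hz ⊢
  exact ⟨fun x y _ => by simpa using h0, fun h x hx => absurd (by simpa using hx) h,
    fun h x hx => absurd (by simpa using hx) h⟩

/-- A double induction, on the degree bound and on the number of polynomials allowed to reach it.
Removing one of these adds many new polynomials, but all of smaller degree; hence L stays arbitrary
in the inner induction. -/
theorem isDetermined_of_natDegree_le (d : ℕ) :
    ∀ L : Finset A[X], (∀ p ∈ L, p.natDegree ≤ d) → IsDetermined L := by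
  classical
  induction d with
  | zero => exact fun L hL => isDetermined_of_natDegree_eq_zero fun p hp => Nat.le_zero.1 (hL p hp)
  | succ d ih =>
    have key : ∀ K : Finset A[X], (∀ p ∈ K, p.natDegree ≤ d + 1) →
        ∀ L : Finset A[X], (∀ p ∈ L, p.natDegree ≤ d) → IsDetermined (L ∪ K) := by
      intro K
      induction K using Finset.induction_on with
      | empty =>
        intro _ L hL
        rw [Finset.union_empty]
        exact ih L hL
      | insert p K _ ihK =>
        intro hK L hL
        rw [Finset.union_insert]
        have hp := hK p (Finset.mem_insert_self _ _)
        have hK' : ∀ q ∈ K, q.natDegree ≤ d + 1 := fun q hq => hK q (Finset.mem_insert_of_mem hq)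
        refine IsDetermined.insert_of_reductions (d := d + 1) (by omega) hp ?_ ?_
        · intro q hq
          rcases Finset.mem_union.1 hq with hq | hq
          · exact (hL q hq).trans (by omega)
          · exact hK' q hq
        refine (ihK hK' (insert (derivative p) (L ∪ reductions (d + 1) p (L ∪ K))) ?_).mono ?_
        · intro q hq
          simp only [Finset.mem_insert, Finset.mem_union] at hq
          rcases hq with rfl | hq | hq
          · exact (natDegree_derivative_le p).trans (by omega)
          · exact hL q hq
          · exact Nat.lt_succ_iff.1 (natDegree_lt_of_mem_reductions (by omega) hq)
        · intro q hq
          simp only [Finset.mem_insert, Finset.mem_union] at hq ⊢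
          tauto
    intro L hL
    simpa using key L hL ∅ (by simp)

/-- Elimination of one real variable: the sign conditions on `L` that are realized over a point
depend only on the signs of finitely many functions of that point. -/
theorem exists_signEq_imp_exists_sign_eval_eq (L : Finset A[X]) :
    ∃ S : Finset A, ∀ a b : A →+* ℝ, SignEq S a b → ∀ x, ∃ y, ∀ p ∈ L,
      SignType.sign ((p.map a).eval x) = SignType.sign ((p.map b).eval y) := by
  obtain ⟨S, hS⟩ := isDetermined_of_natDegree_le (L.sup natDegree) L
    fun p hp => Finset.le_sup (f := natDegree) hp
  refine ⟨S, fun a b hab x => ?_⟩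
  obtain ⟨T, hT, hTL⟩ := hS a b hab
  obtain ⟨y, hy⟩ := hT.exists_samePosition x
  exact ⟨y, fun p hp => (hTL p hp).sign_eq x y hy⟩

end Elimination

/-! ### Sign-determined sets: closure properties and semialgebraicity. -/

section SignDetermined

variable {σ : Type*}

/-- Membership in `C` depends only on the signs of finitely many polynomials. -/
def SignDetermined (C : Set (σ → ℝ)) : Prop :=
  ∃ S : Finset (MvPolynomial σ ℝ), ∀ a b : σ → ℝ,
    SignEq S (MvPolynomial.eval a) (MvPolynomial.eval b) → a ∈ C → b ∈ C

/-- Equality of signs is symmetric, so the one-sided implication in the definition is in fact an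
equivalence. -/
theorem SignDetermined.compl {C : Set (σ → ℝ)} (hC : SignDetermined C) : SignDetermined Cᶜ := by
  obtain ⟨S, hS⟩ := hC
  exact ⟨S, fun a b hab ha hb => ha (hS b a (fun s hs => (hab s hs).symm) hb)⟩

theorem SignDetermined.inter {C D : Set (σ → ℝ)} (hC : SignDetermined C) (hD : SignDetermined D) :
    SignDetermined (C ∩ D) := by
  classical
  obtain ⟨S, hS⟩ := hC
  obtain ⟨S', hS'⟩ := hD
  exact ⟨S ∪ S', fun a b hab h => ⟨hS a b (hab.mono Finset.subset_union_left) h.1,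
    hS' a b (hab.mono Finset.subset_union_right) h.2⟩⟩

theorem SignDetermined.iInter {ι : Type*} [Finite ι] {C : ι → Set (σ → ℝ)}
    (hC : ∀ i, SignDetermined (C i)) : SignDetermined (⋂ i, C i) := by
  classical
  have := Fintype.ofFinite ι
  choose S hS using hC
  refine ⟨Finset.univ.biUnion S, fun a b hab h => ?_⟩
  rw [mem_iInter] at h ⊢
  exact fun i => hS i a b
    (hab.mono (Finset.subset_biUnion_of_mem S (Finset.mem_univ i))) (h i)

theorem SignDetermined.iUnion {ι : Type*} [Finite ι] {C : ι → Set (σ → ℝ)}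
    (hC : ∀ i, SignDetermined (C i)) : SignDetermined (⋃ i, C i) := by
  rw [← compl_compl (⋃ i, C i), compl_iUnion]
  exact (SignDetermined.iInter fun i => (hC i).compl).compl

theorem signDetermined_lt (p q : MvPolynomial σ ℝ) :
    SignDetermined {w | MvPolynomial.eval w p < MvPolynomial.eval w q} := by
  refine ⟨{q - p}, fun a b hab h => ?_⟩
  have h' := hab (q - p) (Finset.mem_singleton_self _)
  rw [mem_ofPred_eq, ← sub_pos, ← map_sub] at h ⊢
  rw [sign_pos h, eq_comm, sign_eq_one_iff] at h'
  exact h'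

theorem SignDetermined.preimage {τ : Type*} {C : Set (τ → ℝ)} (hC : SignDetermined C)
    (g : τ → MvPolynomial σ ℝ) :
    SignDetermined {a : σ → ℝ | (fun i => MvPolynomial.eval a (g i)) ∈ C} := by
  classical
  obtain ⟨S, hS⟩ := hC
  refine ⟨S.image (MvPolynomial.bind₁ g), fun a b hab h => hS _ _ (fun s hs => ?_) h⟩
  have h' := hab _ (Finset.mem_image_of_mem (MvPolynomial.bind₁ g) hs)
  have he (w : σ → ℝ) : MvPolynomial.eval w (MvPolynomial.bind₁ g s) =
      MvPolynomial.eval (fun i => MvPolynomial.eval w (g i)) s :=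
    MvPolynomial.eval₂Hom_bind₁ _ _ _ _
  rwa [he, he] at h'

open Classical in
/-- A polynomial regarded as a univariate polynomial in the variable `i`. -/
noncomputable def isolateVariable (i : σ) :
    MvPolynomial σ ℝ →ₐ[ℝ] Polynomial (MvPolynomial σ ℝ) :=
  MvPolynomial.aeval fun j => if j = i then Polynomial.X else Polynomial.C (MvPolynomial.X j)

open Classical in
theorem eval_map_isolateVariable (i : σ) (a : σ → ℝ) (t : ℝ) (p : MvPolynomial σ ℝ) :
    ((isolateVariable i p).map (MvPolynomial.eval a)).eval t =
      MvPolynomial.eval (Function.update a i t) p := by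
  induction p using MvPolynomial.induction_on with
  | C r => simp [isolateVariable, MvPolynomial.algebraMap_eq, Polynomial.algebraMap_apply]
  | add p q hp hq => simp [hp, hq]
  | mul_X p j hp =>
    rw [map_mul, Polynomial.map_mul, Polynomial.eval_mul, hp, map_mul]
    by_cases hj : j = i
    · subst hj
      simp [isolateVariable]
    · simp [isolateVariable, hj]

-- The Tarski–Seidenberg projection step: a witness t over a is carried to a witness u over b that
-- realizes the same signs.
open Classical in
theorem SignDetermined.exists_update {C : Set (σ → ℝ)} (hC : SignDetermined C) (i : σ) :
    SignDetermined {a | ∃ t, Function.update a i t ∈ C} := by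
  obtain ⟨S, hS⟩ := hC
  obtain ⟨S', hS'⟩ := exists_signEq_imp_exists_sign_eval_eq (S.image (isolateVariable i))
  refine ⟨S', fun a b hab => ?_⟩
  rintro ⟨t, ht⟩
  obtain ⟨u, hu⟩ := hS' _ _ hab t
  refine ⟨u, hS _ _ (fun s hs => ?_) ht⟩
  have := hu _ (Finset.mem_image_of_mem _ hs)
  rwa [eval_map_isolateVariable, eval_map_isolateVariable] at this

theorem SignDetermined.exists_eq_off {C : Set (σ → ℝ)} (hC : SignDetermined C) (s : Finset σ) :
    SignDetermined {a | ∃ b ∈ C, ∀ j ∉ s, b j = a j} := by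
  classical
  induction s using Finset.induction_on with
  | empty =>
    convert hC using 1
    ext a
    simp [← funext_iff]
  | insert i s his ih =>
    convert ih.exists_update i using 1
    ext a
    constructor
    · rintro ⟨b, hb, hba⟩
      refine ⟨b i, b, hb, fun j hj => ?_⟩
      by_cases hji : j = i
      · subst hji
        simp
      · rw [Function.update_of_ne hji]
        exact hba j (by simp [hji, hj])
    · rintro ⟨t, b, hb, hba⟩
      refine ⟨b, hb, fun j hj => ?_⟩
      simp only [Finset.mem_insert, not_or] at hj
      rw [hba j hj.2, Function.update_of_ne hj.1]

theorem isSemialgebraic_iUnion {ι : Type*} [Finite ι] (F G : ι → Finset (MvPolynomial σ ℝ)) :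
    IsSemialgebraic (⋃ j, {x | (∀ p ∈ F j, MvPolynomial.eval x p = 0) ∧
      (∀ g ∈ G j, 0 < MvPolynomial.eval x g)}) := by
  obtain ⟨N, ⟨e⟩⟩ := Finite.exists_equiv_fin ι
  refine ⟨N, F ∘ e.symm, G ∘ e.symm, ?_⟩
  exact (e.symm.surjective.iUnion_comp fun j => {x | (∀ p ∈ F j, MvPolynomial.eval x p = 0) ∧
      (∀ g ∈ G j, 0 < MvPolynomial.eval x g)}).symm

/-- Finitely many sign vectors exist on S. Each cell is basic semialgebraic, with a negative sign
expressed through -s, and C is the union of the cells that it contains. -/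
theorem SignDetermined.isSemialgebraic {C : Set (σ → ℝ)} (hC : SignDetermined C) :
    IsSemialgebraic C := by
  classical
  obtain ⟨S, hS⟩ := hC
  let cell (v : S → SignType) : Set (σ → ℝ) :=
    {x | ∀ s : S, SignType.sign (MvPolynomial.eval x s.1) = v s}
  let F (v : S → SignType) : Finset (MvPolynomial σ ℝ) :=
    (Finset.univ.filter fun s => v s = 0).image Subtype.val
  let G (v : S → SignType) : Finset (MvPolynomial σ ℝ) :=
    (Finset.univ.filter fun s => v s = 1).image Subtype.val ∪
      (Finset.univ.filter fun s => v s = -1).image fun s => -s.1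
  have hcell : ∀ v, {x | (∀ p ∈ F v, MvPolynomial.eval x p = 0) ∧
      (∀ g ∈ G v, 0 < MvPolynomial.eval x g)} = cell v := by
    intro v
    ext x
    simp only [mem_ofPred_eq, cell]
    constructor
    · rintro ⟨hF, hG⟩ s
      rcases hv : v s with _ | _ | _
      · exact sign_eq_zero_iff.2 (hF s (Finset.mem_image_of_mem _ (by simp [hv])))
      · have := hG (-s) (Finset.mem_union_right _
          (Finset.mem_image.2 ⟨s, by simp [hv], rfl⟩))
        rw [map_neg, neg_pos] at this
        exact sign_neg this
      · exact sign_pos (hG s (Finset.mem_union_left _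
          (Finset.mem_image_of_mem _ (by simp [hv]))))
    · intro h
      refine ⟨fun p hp => ?_, fun g hg => ?_⟩
      · obtain ⟨s, hs, rfl⟩ := Finset.mem_image.1 hp
        rw [← sign_eq_zero_iff, h s]
        exact (Finset.mem_filter.1 hs).2
      · rcases Finset.mem_union.1 hg with hg | hg
        · obtain ⟨s, hs, rfl⟩ := Finset.mem_image.1 hg
          rw [← sign_eq_one_iff, h s]
          exact (Finset.mem_filter.1 hs).2
        · obtain ⟨s, hs, rfl⟩ := Finset.mem_image.1 hg
          rw [map_neg, neg_pos, ← sign_eq_neg_one_iff, h s]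
          exact (Finset.mem_filter.1 hs).2
  have hunion : C = ⋃ v : {v // cell v ⊆ C}, cell v := by
    ext x
    rw [mem_iUnion]
    constructor
    · intro hx
      refine ⟨⟨fun s => SignType.sign (MvPolynomial.eval x s.1), fun y hy => ?_⟩, fun s => rfl⟩
      exact hS x y (fun s hs => (hy ⟨s, hs⟩).symm) hx
    · rintro ⟨v, hv⟩
      exact v.2 hv
  have h := isSemialgebraic_iUnion (fun v : {v // cell v ⊆ C} => F v) (fun v => G v)
  rw [hunion]
  simpa only [hcell] using h

end SignDetermined

/-! ### Application to local Pareto optima. -/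

section Pareto

variable {n m q : ℕ}

/-- The polynomial `f_j(a, x)` in the variables `a` and `x`. -/
noncomputable def polyMapPolynomial {τ : Type*} (a : CoeffIndex n m q → MvPolynomial τ ℝ)
    (x : Fin n → MvPolynomial τ ℝ) (j : Fin m) : MvPolynomial τ ℝ :=
  ∑ ι : multiIndices n q, a (ι, j) * ∏ i, x i ^ ι.1 i

theorem eval_polyMapPolynomial {τ : Type*} (a : CoeffIndex n m q → MvPolynomial τ ℝ)
    (x : Fin n → MvPolynomial τ ℝ) (j : Fin m) (w : τ → ℝ) :
    MvPolynomial.eval w (polyMapPolynomial a x j) =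
      polyMap (fun c => MvPolynomial.eval w (a c)) (fun i => MvPolynomial.eval w (x i)) j := by
  simp [polyMapPolynomial, polyMap]

/-- Sup-norm balls form a basis of neighbourhoods, which turns the quantifier over neighbourhoods
into one over a real number ε. -/
theorem isLocalParetoOptimum_iff {f : (Fin n → ℝ) → Fin m → ℝ} :
    IsLocalParetoOptimum f 0 ↔
      ∃ ε > 0, ¬ ∃ x : Fin n → ℝ, (∀ i, |x i| < ε) ∧ Dominates f x 0 := by
  constructor
  · rintro ⟨U, hU, -, h⟩
    obtain ⟨ε, hε, hball⟩ := Metric.mem_nhds_iff.1 hU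
    refine ⟨ε, hε, fun ⟨x, hx, hdom⟩ => h ⟨x, hball ?_, hdom⟩⟩
    rw [mem_ball_zero_iff, pi_norm_lt_iff hε]
    exact hx
  · rintro ⟨ε, hε, h⟩
    refine ⟨Metric.ball 0 ε, Metric.ball_mem_nhds 0 hε, Metric.mem_ball_self hε, ?_⟩
    rintro ⟨x, hx, hdom⟩
    rw [mem_ball_zero_iff, pi_norm_lt_iff hε] at hx
    exact h ⟨x, hx, hdom⟩

/-- The triples `(a, x, ε)` such that `x` lies in the `ε`-cube and dominates `0`. -/
def dominatingSet (n m q : ℕ) : Set (CoeffIndex n m q ⊕ Option (Fin n) → ℝ) :=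
  {w | (∀ i, |w (.inr (some i))| < w (.inr none)) ∧
    Dominates (polyMap fun c => w (.inl c)) (fun i => w (.inr (some i))) 0}

theorem signDetermined_dominatingSet : SignDetermined (dominatingSet n m q) := by
  let ε : MvPolynomial (CoeffIndex n m q ⊕ Option (Fin n)) ℝ := .X (.inr none)
  let x (i : Fin n) : MvPolynomial (CoeffIndex n m q ⊕ Option (Fin n)) ℝ := .X (.inr (some i))
  let f (j : Fin m) := polyMapPolynomial (q := q) (fun c => .X (.inl c)) x j
  let f₀ (j : Fin m) : MvPolynomial (CoeffIndex n m q ⊕ Option (Fin n)) ℝ :=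
    polyMapPolynomial (q := q) (fun c => .X (.inl c)) 0 j
  have h := ((SignDetermined.iInter fun i => (signDetermined_lt (-ε) (x i)).inter
    (signDetermined_lt (x i) ε)).inter (SignDetermined.iInter fun j =>
      (signDetermined_lt (f j) (f₀ j)).compl)).inter
    (SignDetermined.iUnion fun j => signDetermined_lt (f₀ j) (f j))
  convert h using 1
  ext w
  have h0 : (fun i : Fin n => MvPolynomial.eval w
      ((0 : Fin n → MvPolynomial (CoeffIndex n m q ⊕ Option (Fin n)) ℝ) i)) = 0 := by
    ext i
    simp
  simp only [dominatingSet, Dominates, mem_inter_iff, mem_iInter, mem_iUnion, mem_ofPred_eq,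
    mem_compl_iff, f, f₀, eval_polyMapPolynomial, h0, x, ε, map_neg, MvPolynomial.eval_X, not_lt,
    ge_iff_le, gt_iff_lt, abs_lt, and_assoc]

theorem signDetermined_isLocalParetoOptimum :
    SignDetermined {a : CoeffIndex n m q → ℝ | IsLocalParetoOptimum (polyMap a) 0} := by
  classical
  let xs : Finset (CoeffIndex n m q ⊕ Option (Fin n)) :=
    Finset.univ.image fun i => .inr (some i)
  -- Eliminate x, negate, impose ε > 0, eliminate ε. The resulting set does not depend on the
  -- coordinates x and ε, so substituting 0 for them brings it back to the coefficient space.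
  have h := ((((signDetermined_dominatingSet (n := n) (m := m) (q := q)).exists_eq_off
    xs).compl.inter (signDetermined_lt 0 (.X (.inr none)))).exists_update
      (.inr none)).preimage (Sum.elim .X (fun _ => (0 : MvPolynomial (CoeffIndex n m q) ℝ)))
  convert h using 1
  ext a
  simp only [mem_ofPred_eq, isLocalParetoOptimum_iff, mem_inter_iff, mem_compl_iff, map_zero,
    MvPolynomial.eval_X, Function.update_self]
  refine exists_congr fun ε => ?_
  rw [and_comm]
  refine and_congr_left fun hε => not_congr ?_
  constructor
  · rintro ⟨x, hx, hdom⟩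
    refine ⟨Sum.elim a fun o => o.elim ε x, ⟨hx, hdom⟩, ?_⟩
    rintro (c | _ | i) hj
    · simp
    · simp
    · simp [xs] at hj
  · rintro ⟨b, ⟨hb, hdom⟩, hba⟩
    have h1 : (fun c => b (.inl c)) = a := by
      ext c
      rw [hba _ (by simp [xs])]
      simp
    have h2 : b (.inr none) = ε := by
      rw [hba _ (by simp [xs])]
      simp
    rw [h1] at hdom
    rw [h2] at hb
    exact ⟨_, hb, hdom⟩

end Pareto

end ParetoSemialg

theorem mainTheorem5 (n m q : ℕ) :
    ParetoSemialg.IsSemialgebraic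
      {a : ParetoSemialg.CoeffIndex n m q → ℝ |
        ParetoSemialg.IsLocalParetoOptimum (ParetoSemialg.polyMap a) (0 : Fin n → ℝ)} :=
  ParetoSemialg.signDetermined_isLocalParetoOptimum.isSemialgebraic
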